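/- Let $p$ be an odd prime, and let $G$ be a finite group of order $16p$ whose Sylow $p$-subgroups are normal. Assume that $G/G' \cong \mathbb{Z}_4 \times \mathbb{Z}_2$, where $G' = [G,G]$ is the commutator subgroup of $G$. Then for every generating set $S$ of $G$, the Cayley graph $\mathrm{Cay}(G;S)$ has a hamiltonian cycle. Here $\mathrm{Cay}(G;S)$ is the undirected simple graph with vertex set $G$ in which two distinct elements $g,h \in G$ are adjacent if and only if $g^{-1}h \in S$ or $h^{-1}g \in S$, and a hamiltonian cycle is a cycle that visits every vertex exactly once. -/

import Mathlib

/-! Let `P` be the normal Sylow `p`-subgroup, of order `p`. Since `G/G'` is a 2-group, `P` lies in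
`G'` with index 2, so `Q = G/P` is nonabelian of order 16, with elements `a ^ i * b ^ j * z ^ k`,
where `z` is central and generates `Q'`; only `a ^ 4` and `b ^ 2`, each `1` or `z`, remain to be
specified (`exists_normalForm`). `P` has a complement, so `G` acts on `P ≅ ℤ/p` through a character
`χ` of `G/G'`, and taking the `P`-component is a crossed homomorphism `τ` (`exists_cocycle`). The
character is nontrivial: otherwise `τ` would be a homomorphism to an abelian group and would kill `P
≤ G'`.

The values of `χ` are powers of a square root of `-1` in the algebraic closure of `ℤ/p`, so all
computations take place in `ℤ[i] ⋊ Q`, uniformly in `p`. The set `S` contains `x`, `y` that generate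
`G/G'`. A coboundary and a scalar bring `τ` to the values 0 and 1 on them, or to 0 on both and 1 on
some third `c ∈ S` (`exists_normalized`). This leaves finitely many cases. In each, a table gives a
hamiltonian cycle of length 16 in `Q`, and generically `τ` of its product is a Gaussian integer of
norm dividing 1024, hence nonzero in odd characteristic. The product then generates `P`, and
repeating the word `p` times is a hamiltonian cycle (factor group lemma).

Two situations escape. If `c ∈ P`, the cosets of `P` are traversed by powers of `c` between the
letters of the word. In one two-generator case the norm only divides 144, and `p = 3` needs an
explicit word of length 48. -/

/-- The list `a, f a s₁, f (f a s₁) s₂, …` of the partial results of a left fold over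
`s₁, s₂, …`, without the last one. -/
def partialFolds {α β : Type*} (f : α → β → α) (a : α) : List β → List α
  | [] => []
  | s :: w => a :: partialFolds f (f a s) w

/-! ### Words as walks in Cayley graphs, and the factor group lemma -/

section CayleyWords

variable {G : Type*} [Group G]

/-- The vertices visited by a word that is read from `g`, without the last vertex. -/
abbrev partialProds (g : G) (w : List G) : List G := partialFolds (· * ·) g w

@[simp] lemma partialProds_nil (g : G) : partialProds g [] = [] := rfl

@[simp] lemma partialProds_cons (g s : G) (w : List G) :
    partialProds g (s :: w) = g :: partialProds (g * s) w := rfl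

lemma partialProds_append (w₁ w₂ : List G) (g : G) :
    partialProds g (w₁ ++ w₂) = partialProds g w₁ ++ partialProds (g * w₁.prod) w₂ := by
  induction w₁ generalizing g with
  | nil => simp
  | cons s w ih => simp [ih, mul_assoc]

lemma partialProds_mul (w : List G) (g h : G) :
    partialProds (g * h) w = (partialProds h w).map (g * ·) := by
  induction w generalizing h with
  | nil => rfl
  | cons s w ih => simp [← ih, mul_assoc]

lemma exists_walk_of_word {S : Set G} (w : List G) (hw : ∀ s ∈ w, s ∈ S ∨ s⁻¹ ∈ S)
    (h1 : ∀ s ∈ w, s ≠ 1) (g : G) :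
    ∃ W : (SimpleGraph.mulCayley S).Walk g (g * w.prod),
      W.support = partialProds g w ++ [g * w.prod] := by
  induction w generalizing g with
  | nil =>
    have h : g = g * ([] : List G).prod := by rw [List.prod_nil, mul_one]
    exact ⟨SimpleGraph.Walk.nil.copy rfl h, by rw [SimpleGraph.Walk.support_copy]; simp⟩
  | cons s w ih =>
    obtain ⟨W, hW⟩ := ih (fun t ht => hw t (by simp [ht])) (fun t ht => h1 t (by simp [ht])) (g * s)
    have hadj : (SimpleGraph.mulCayley S).Adj g (g * s) := by
      rw [SimpleGraph.mulCayley_adj]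
      exact ⟨by simpa using (h1 s (by simp)), by simpa using hw s (by simp)⟩
    exact ⟨(SimpleGraph.Walk.cons hadj W).copy rfl (by simp [mul_assoc]), by simp [hW, mul_assoc]⟩

/-- A closed word in the generators and their inverses that visits `Nat.card G ≥ 3` distinct
elements is a hamiltonian cycle of the Cayley graph. -/
theorem exists_isHamiltonianCycle_of_word [DecidableEq G] {S : Set G} (w : List G)
    (hw : ∀ s ∈ w, s ∈ S ∨ s⁻¹ ∈ S) (h1 : ∀ s ∈ w, s ≠ 1) (hnd : (partialProds 1 w).Nodup)
    (hprod : w.prod = 1) (hlen : w.length = Nat.card G) (h3 : 3 ≤ Nat.card G) :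
    ∃ (v : G) (C : (SimpleGraph.mulCayley S).Walk v v), C.IsHamiltonianCycle := by
  have : Finite G := Nat.finite_of_card_ne_zero (by omega)
  have := Fintype.ofFinite G
  obtain ⟨W, hW⟩ := exists_walk_of_word w hw h1 1
  have key : ∀ (x : G) (hx : x = 1) (W : (SimpleGraph.mulCayley S).Walk 1 x),
      W.support = partialProds 1 w ++ [x] →
      ∃ (v : G) (C : (SimpleGraph.mulCayley S).Walk v v), C.IsHamiltonianCycle := by
    rintro _ rfl C hC
    have hl : C.length = Nat.card G := by
      have hp : ∀ (w : List G) (g : G), (partialProds g w).length = w.length := by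
        intro w
        induction w with
        | nil => simp
        | cons s w ih => simp [ih]
      have := C.length_support
      rw [hC] at this
      simp [hp] at this
      omega
    refine ⟨1, C, ?_⟩
    rw [SimpleGraph.Walk.isHamiltonianCycle_iff_isCycle_and_length_eq,
      SimpleGraph.Walk.isCycle_iff_isPath_tail_and_le_length]
    refine ⟨⟨?_, by omega⟩, by rw [hl, Nat.card_eq_fintype_card]⟩
    have hnil : ¬C.Nil := SimpleGraph.Walk.not_nil_iff_lt_length.2 (by omega)
    rw [SimpleGraph.Walk.isPath_def, SimpleGraph.Walk.support_tail_of_not_nil _ hnil, hC]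
    cases w with
    | nil => rw [List.length_nil] at hlen; omega
    | cons s w =>
      simp only [partialProds_cons, one_mul, List.cons_append, List.tail_cons] at hnd ⊢
      -- Dropping the initial vertex 1 and appending the final vertex 1 only rotates the list of
      -- partial products.
      exact (List.perm_append_comm.nodup_iff).2 (by simpa using hnd)
  exact key _ (by simpa using hprod) W hW

/-- The factor group lemma: if a word `w` visits distinct cosets of the cyclic group generated by
its product `h`, then the word `w, w, …, w` visits distinct elements. -/
theorem nodup_partialProds_replicate_flatten {β : Type*} (w : List G) (π : G → β)
    (hnd : ((partialProds 1 w).map π).Nodup) (hπ : ∀ g, π (w.prod * g) = π g) :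
    (partialProds 1 (List.replicate (orderOf w.prod) w).flatten).Nodup := by
  set h := w.prod with hh
  have hpow : ∀ (n : ℕ) (g : G), π (h ^ n * g) = π g := by
    intro n
    induction n with
    | zero => simp
    | succ n ih => intro g; rw [pow_succ', mul_assoc, hπ, ih]
  -- Copy `i` of `w` starts at `h ^ i`, so it visits the translates by `h ^ i` of what the first
  -- copy visits.
  have hflat : ∀ n : ℕ, partialProds 1 (List.replicate n w).flatten =
      (List.range n).flatMap fun i => (partialProds 1 w).map (h ^ i * ·) := by
    intro n
    induction n with
    | zero => simp
    | succ n ih =>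
      have hp : (List.replicate n w).flatten.prod = h ^ n := by simp [List.prod_flatten, hh]
      rw [List.replicate_succ', List.flatten_append, partialProds_append, ih, List.range_succ,
        List.flatMap_append, hp, one_mul]
      have := partialProds_mul w (h ^ n) 1
      rw [mul_one] at this
      simp [this]
  rw [hflat, List.nodup_flatMap]
  refine ⟨fun i _ => (hnd.of_map π).map (mul_right_injective _), ?_⟩
  refine List.Nodup.pairwise_of_forall_ne List.nodup_range fun i hi j hj hij => ?_
  intro x hx hx'
  obtain ⟨y, hy, rfl⟩ := List.mem_map.1 hx
  obtain ⟨y', hy', he⟩ := List.mem_map.1 hx'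
  have hyy : y' = y := List.inj_on_of_nodup_map hnd hy' hy (by
    have := congrArg π he
    simpa only [hpow] using this)
  subst hyy
  exact hij (pow_injOn_Iio_orderOf (by simpa using hi) (by simpa using hj)
    (mul_right_cancel he).symm)

end CayleyWords

/-! ### Normal forms for the groups of order 16, and the model `ℤ[i] ⋊ Q` -/

section NormalForms

/-- The triple `(i, j, k)` stands for the element `a ^ i * b ^ j * z ^ k` of the group of order 16
with presentation `a ^ 4 = z ^ δ`, `b ^ 2 = z ^ ε`, `z ^ 2 = 1`, `b * a = a * b * z`, `z` central. -/
abbrev NormalForm := Fin 4 × Fin 2 × Fin 2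

namespace NormalForm

/-- Multiplication of normal forms. -/
def mul (δ ε : Fin 2) (x y : NormalForm) : NormalForm :=
  -- Powers of `z` arise from moving `b ^ j` past `a ^ i'`, from the carry at `a ^ 4`, and from the
  -- carry at `b ^ 2`.
  (x.1 + y.1, x.2.1 + y.2.1, x.2.2 + y.2.2 + Fin.ofNat 2 (x.2.1.val * y.1.val +
    δ.val * ((x.1.val + y.1.val) / 4) + ε.val * ((x.2.1.val + y.2.1.val) / 2)))

/-- Inversion of normal forms. -/
def inv (δ ε : Fin 2) (x : NormalForm) : NormalForm :=
  -- The product of `x` with the candidate `(-i, -j, 0)` is a power of `z`, which is its own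
  -- inverse.
  (-x.1, -x.2.1, (mul δ ε x (-x.1, -x.2.1, 0)).2.2)

lemma mul_zero : ∀ (δ ε : Fin 2) (x : NormalForm), mul δ ε x 0 = x := by
  decide

/-- Normal forms are not given a group structure; this bit of cancellation is what forces `pos 1 =
0`. -/
lemma mul_left_cancel_zero : ∀ (δ ε : Fin 2) (x y : NormalForm), mul δ ε x y = x → y = 0 := by
  decide +kernel

lemma zero_mul : ∀ (δ ε : Fin 2) (x : NormalForm), mul δ ε 0 x = x := by
  decide

/-- The exponent `e` such that a character with value `I ^ m` at `a` and `I ^ (2 * n)` at `b` has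
the value `I ^ e` at `a ^ i * b ^ j * z ^ k`. -/
def charExp (m : Fin 4) (n : Fin 2) (x : NormalForm) : ℕ := m.val * x.1.val + 2 * n.val * x.2.1.val

end NormalForm

/-- A model of the elements of `ℤ[i] ⋊ Q`, where `Q` is the group of normal forms. -/
abbrev ModelElt := NormalForm × GaussianInt

namespace ModelElt

/-- The image in `ℤ[i]` of the character. -/
def char (m : Fin 4) (n : Fin 2) (x : NormalForm) : GaussianInt :=
  (⟨0, 1⟩ : GaussianInt) ^ NormalForm.charExp m n x

/-- Multiplication in the semidirect product. -/
def mul (δ ε : Fin 2) (m : Fin 4) (n : Fin 2) (x y : ModelElt) : ModelElt :=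
  (NormalForm.mul δ ε x.1 y.1, x.2 + char m n x.1 * y.2)

/-- Inversion in the semidirect product. -/
def inv (δ ε : Fin 2) (m : Fin 4) (n : Fin 2) (x : ModelElt) : ModelElt :=
  (NormalForm.inv δ ε x.1, -(char m n (NormalForm.inv δ ε x.1) * x.2))

/-- The product of a word, multiplied on the left by `x`. -/
def prodFrom (δ ε : Fin 2) (m : Fin 4) (n : Fin 2) (x : ModelElt) (w : List ModelElt) : ModelElt :=
  w.foldl (mul δ ε m n) x

end ModelElt

end NormalForms

/-! ### Tables of words, verified by computation -/

section WordTables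

/-- The word of length 16 that is encoded by the base 6 digits of a number. -/
def decodeWord (N : ℕ) : List (Fin 6) := (List.range 16).map fun i => Fin.ofNat 6 (N / 6 ^ i)

/-- The six letters `x`, `y`, `c`, `x⁻¹`, `y⁻¹`, `c⁻¹` in the model. -/
def modelLetter (δ ε : Fin 2) (m : Fin 4) (n : Fin 2) (x y c : ModelElt) : Fin 6 → ModelElt :=
  ![x, y, c, x.inv δ ε m n, y.inv δ ε m n, c.inv δ ε m n]

/-- The pairs of exponents that describe the nontrivial characters of `ℤ/4 × ℤ/2`, up to complex
conjugation. -/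
def charPair : Fin 5 → Fin 4 × Fin 2 := ![(0, 1), (2, 0), (2, 1), (1, 0), (1, 1)]

/-- The six letters `x`, `y`, `c`, `x⁻¹`, `y⁻¹`, `c⁻¹` as normal forms. -/
def normalFormLetter (δ ε : Fin 2) (x y c : NormalForm) : Fin 6 → NormalForm :=
  ![x, y, c, x.inv δ ε, y.inv δ ε, c.inv δ ε]

/-- The normal forms visited by a word are distinct, and the word represents the identity. -/
def IsQuotientCycle (δ ε : Fin 2) (w : List NormalForm) : Prop :=
  (partialFolds (NormalForm.mul δ ε) 0 w).Nodup ∧ w.foldl (NormalForm.mul δ ε) 0 = 0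

instance (δ ε : Fin 2) (w : List NormalForm) : Decidable (IsQuotientCycle δ ε w) :=
  inferInstanceAs (Decidable (_ ∧ _))

/-- Hamiltonian cycles of the Cayley graphs of order 16 with two generators. -/
def twoGeneratorWords : List (List ℕ) := [
  [718711473534, 1881103015512, 470548061784, 1881103015512, 751569653592],
  [2129448517848, 1881103855320, 1881103855320, 2129448517848, 2162125447128],
  [2243366793432, 1881103855320, 1881103855320, 2202919960536, 2202919960536],
  [2176285217652, 470548061784, 2161907936856, 470548061784, 2161907936856],
  [751353150312, 2161908104040, 751353150312, 751353150312, 751353150312],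
  [1884065585760, 470185264512, 1884065585760, 470185264512, 1884065585760],
  [2135979425808, 1934433910368, 752295247488, 752295247488, 752295247488],
  [1881018762336, 1880741058048, 1881018762336, 1881018762336, 1880741058048]]

/-- Hamiltonian cycles of the Cayley graphs of order 16 with three generators. -/
def threeGeneratorWords : List (List ℕ) := [
  [470548061784, 2615242339743, 84051392546, 1616099737047, 1797756081083, 938329980855,
   1144489797502, 1902136351313, 1523662905261, 381061247602, 484850603547, 1577901095392,
   461425785805, 1885190642165, 2129717203629, 2818580085985],
  [1881103855320, 533737715220, 2610054831058, 2184107569245, 487470242493, 1557702547561,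
   1901793657678, 2220850102709, 729897696677, 14790830231, 2229798371254, 2717075255442,
   1625159755700, 1670984670813, 2789674924447, 1000392458960],
  [1881103855320, 2244959982634, 1879726408443, 20756033610, 1933563304464, 962004695011,
   2714509939653, 1533220992568, 773564279875, 1805263801807, 1285041745812, 35562974682,
   495639966575, 2444210673870, 366559825936, 1322324821317],
  [470548061784, 1660741041305, 2062843469769, 2664797504968, 2507375209245, 388480411660,
   1536905335709, 374651121196, 906029780330, 748893951633, 2743712513778, 1314415467577,
   2288209218472, 75439427275, 2097254536677, 1281760527324],
  [751353150312, 965562462561, 483992563620, 1562567040963, 2180637513263, 198854375916,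
   993576109196, 1240466392221, 1573225576519, 1572131113749, 209809044173, 906244249061,
   2472938856252, 1682645064547, 391220463295, 645638215037],
  [470185264512, 554510827175, 1224303408604, 2634720872824, 1297194976222, 1117632341658,
   501518791592, 1626588320171, 558468045331, 1109802956620, 941314932156, 2158530896706,
   574781746286, 1068338603722, 1535208588506, 614842042260],
  [752295247488, 59198309648, 65898350159, 21049954946, 474978012549, 1709358952177,
   500589010478, 903741164615, 2747816394801, 2160152084916, 553394599272, 13113816654,
   998560329007, 2207137767363, 1816298522927, 1264427019852],
  [1880741058048, 585126494655, 1503841571482, 393323127844, 491056488081, 1038907448968,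
   1610913063201, 1818838004942, 1243874253530, 490306712678, 1778270210980, 1665936155908,
   1489693533319, 675747462714, 2715677651082, 2141999502050]]

/-- The table entry for two generators. -/
def twoGeneratorWord (δ ε t : Fin 2) (k : Fin 5) : List (Fin 6) :=
  -- Rows are indexed by the group and by `t`, columns by the character. The tables are full, so the
  -- default values are never used.
  decodeWord ((twoGeneratorWords.getD (4 * δ.val + 2 * ε.val + t.val) []).getD k.val 0)

/-- The table entry for three generators, the third of which has normal form `q`. -/
def threeGeneratorWord (δ ε t : Fin 2) (q : NormalForm) : List (Fin 6) :=
  decodeWord ((threeGeneratorWords.getD (4 * δ.val + 2 * ε.val + t.val) []).getD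
    (4 * q.1.val + 2 * q.2.1.val + q.2.2.val) 0)

/-- The letters for two generators `x`, `y`, with cocycle normalized in terms of the character. -/
def twoGeneratorLetter (δ ε t : Fin 2) (k : Fin 5) : Fin 6 → ModelElt :=
  -- The cocycle is made to vanish at a generator with nontrivial character: `y` if the character is
  -- trivial at `a`, else `x`. The third letter is a dummy copy of `x`.
  let u : GaussianInt := if (charPair k).1 = 0 then 1 else 0
  modelLetter δ ε (charPair k).1 (charPair k).2 ((1, 0, 0), u) ((Fin.castLE (by omega) t, 1, 0), 1 - u)
    ((1, 0, 0), u)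

/-- The letters for three generators, on two of which the cocycle vanishes. -/
def threeGeneratorLetter (δ ε t : Fin 2) (q : NormalForm) (k : Fin 5) : Fin 6 → ModelElt :=
  modelLetter δ ε (charPair k).1 (charPair k).2 ((1, 0, 0), 0) ((Fin.castLE (by omega) t, 1, 0), 0)
    (q, 1)

theorem twoGeneratorWord_isQuotientCycle (δ ε t : Fin 2) (k : Fin 5) :
    IsQuotientCycle δ ε ((twoGeneratorWord δ ε t k).map
      (normalFormLetter δ ε (1, 0, 0) (Fin.castLE (by omega) t, 1, 0) (1, 0, 0))) := by
  revert δ ε t k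
  decide +kernel

/-- Divisibility also excludes norm 0, so the cocycle value survives in every odd characteristic,
apart from characteristic 3 in the one exceptional case. -/
theorem norm_twoGeneratorWord (δ ε t : Fin 2) (k : Fin 5) :
    Zsqrtd.norm (ModelElt.prodFrom δ ε (charPair k).1 (charPair k).2 (0, 0)
      ((twoGeneratorWord δ ε t k).map (twoGeneratorLetter δ ε t k))).2 ∣
        if (δ, ε, t, k) = (1, 0, 0, 0) then 144 else 1024 := by
  revert δ ε t k
  decide +kernel

theorem threeGeneratorWord_isQuotientCycle (δ ε t : Fin 2) (q : NormalForm) :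
    IsQuotientCycle δ ε ((threeGeneratorWord δ ε t q).map
      (normalFormLetter δ ε (1, 0, 0) (Fin.castLE (by omega) t, 1, 0) q)) := by
  revert δ ε t q
  decide +kernel

/-- The case `q = 0` must be left out: there a cycle of the quotient cannot use `c`, and the cocycle
vanishes on all other letters. -/
theorem norm_threeGeneratorWord (δ ε t : Fin 2) (q : NormalForm) (hq : q ≠ 0) (k : Fin 5) :
    Zsqrtd.norm (ModelElt.prodFrom δ ε (charPair k).1 (charPair k).2 (0, 0)
      ((threeGeneratorWord δ ε t q).map (threeGeneratorLetter δ ε t q k))).2 ∣ 1024 := by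
  revert δ ε t q k
  decide +kernel

/-- Each factor `c⁻¹` contributes minus the character at the vertex where it is read, and the other
letters contribute nothing. The total is minus the sum of a nontrivial character over all of `Q`,
which is 0. -/
theorem prodFrom_interleave_threeGeneratorWord (δ ε t : Fin 2) (k : Fin 5) :
    ModelElt.prodFrom δ ε (charPair k).1 (charPair k).2 (0, 0)
      ((threeGeneratorWord δ ε t 0).map fun l =>
        ModelElt.mul δ ε (charPair k).1 (charPair k).2 (threeGeneratorLetter δ ε t 0 k 5)
          (threeGeneratorLetter δ ε t 0 k l)) = (0, 0) := by
  revert δ ε t k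
  decide +kernel

/-- The word `(x ^ 5 * y) ^ 8`. -/
def exceptionalWord : List (Fin 6) := (List.replicate 8 [0, 0, 0, 0, 0, 1]).flatten

theorem exceptionalWord_nodup :
    ((partialFolds (ModelElt.mul 1 0 0 1) (0, 0)
      (exceptionalWord.map (twoGeneratorLetter 1 0 0 0))).map fun x => (x.1, x.2.re % 3)).Nodup := by
  decide +kernel

/-- The character here takes only the values `1` and `-1`, so cocycle values are ordinary integers
and can be compared modulo 3. -/
theorem im_partialProds_exceptionalWord :
    ∀ x ∈ partialFolds (ModelElt.mul 1 0 0 1) (0, 0)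
      (exceptionalWord.map (twoGeneratorLetter 1 0 0 0)), x.2.im = 0 := by
  decide +kernel

theorem prodFrom_exceptionalWord :
    ModelElt.prodFrom 1 0 0 1 (0, 0) (exceptionalWord.map (twoGeneratorLetter 1 0 0 0)) =
      (0, 0) := by
  decide +kernel

end WordTables

/-! ### Traversing cosets of a cyclic subgroup between letters -/

section Interleave

variable {G : Type*} [Group G]

/-- If the word with letters `c⁻¹ * s`, for `s` in `w`, visits distinct left cosets of the group
generated by `c`, then following the whole coset before each letter of `w` visits distinct
elements. -/
theorem nodup_partialProds_flatMap_replicate {β : Type*} (c : G) (hc : 0 < orderOf c) (w : List G)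
    (π : G → β) (hπ : ∀ g, π (g * c) = π g)
    (hnd : ((partialProds 1 (w.map (c⁻¹ * ·))).map π).Nodup) :
    (partialProds 1 (w.flatMap fun s => List.replicate (orderOf c - 1) c ++ [s])).Nodup := by
  have hpow : ∀ (n : ℕ) (g : G), π (g * c ^ n) = π g := by
    intro n
    induction n with
    | zero => simp
    | succ n ih => intro g; rw [pow_succ, ← mul_assoc, hπ, ih]
  have hrep : ∀ (n : ℕ) (g : G), partialProds g (List.replicate n c) =
      (List.range n).map fun i => g * c ^ i := by
    intro n
    induction n with
    | zero => simp
    | succ n ih =>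
      intro g
      rw [List.replicate_succ', partialProds_append, ih, List.range_succ]
      simp
  have hblock : ∀ g s : G, partialProds g (List.replicate (orderOf c - 1) c ++ [s]) =
      (List.range (orderOf c)).map fun i => g * c ^ i := by
    intro g s
    obtain ⟨n, hn⟩ : ∃ n, orderOf c = n + 1 := ⟨orderOf c - 1, by omega⟩
    rw [partialProds_append, hrep, hn, List.range_succ]
    simp
  -- Traversing a whole coset and then reading `s` has the net effect of `c⁻¹ * s`.
  have hcinv : c ^ (orderOf c - 1) = c⁻¹ := by
    rw [eq_inv_iff_mul_eq_one, ← pow_succ, Nat.sub_add_cancel hc, pow_orderOf_eq_one]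
  have hflat : ∀ g : G, partialProds g (w.flatMap fun s => List.replicate (orderOf c - 1) c ++ [s])
      = (partialProds g (w.map (c⁻¹ * ·))).flatMap fun u =>
        (List.range (orderOf c)).map fun i => u * c ^ i := by
    clear hnd
    induction w with
    | nil => simp
    | cons s w ih =>
      intro g
      rw [List.flatMap_cons, partialProds_append, hblock, List.map_cons, partialProds_cons,
        List.flatMap_cons, ih]
      simp [hcinv]
  rw [hflat, List.nodup_flatMap]
  refine ⟨fun u _ => List.Nodup.map_on (fun i hi j hj h => ?_) List.nodup_range, ?_⟩
  · exact pow_injOn_Iio_orderOf (by simpa using hi) (by simpa using hj) (mul_left_cancel h)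
  · refine List.Nodup.pairwise_of_forall_ne (hnd.of_map π) fun u hu v hv huv => ?_
    intro x hx hx'
    obtain ⟨i, _, rfl⟩ := List.mem_map.1 hx
    obtain ⟨j, _, he⟩ := List.mem_map.1 hx'
    exact huv (List.inj_on_of_nodup_map hnd hu hv (by
      have := congrArg π he
      simpa only [hpow] using this.symm))

end Interleave

/-! ### Coordinates on `G`, and hamiltonian cycles for normalized generators -/

section Coordinates

/-- A group with a homomorphism `pos` to a group of normal forms, together with a crossed
homomorphism to a field that is injective on the kernel of `pos`. -/
structure CocycleCoordinates (G : Type*) [Group G] {F : Type*} [Field F] (φ : GaussianInt →+* F)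
    (δ ε : Fin 2) (m : Fin 4) (n : Fin 2) where
  /-- the normal form of an element -/
  pos : G → NormalForm
  /-- the crossed homomorphism -/
  cocycle : G → F
  pos_mul : ∀ g h, pos (g * h) = (pos g).mul δ ε (pos h)
  cocycle_mul : ∀ g h, cocycle (g * h) = cocycle g + φ (ModelElt.char m n (pos g)) * cocycle h
  eq_one : ∀ g, pos g = 0 → cocycle g = 0 → g = 1

namespace NormalForm

lemma eq_inv_of_mul_eq_zero : ∀ (δ ε : Fin 2) (x y : NormalForm),
    mul δ ε x y = 0 → y = inv δ ε x := by
  decide +kernel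

end NormalForm

lemma ModelElt.char_zero (m : Fin 4) (n : Fin 2) : ModelElt.char m n 0 = 1 := by
  simp [ModelElt.char, NormalForm.charExp]

/-- The norm is `t` times its conjugate, so a zero `φ t` would kill the norm and then its multiple
`N`. -/
lemma map_gaussianInt_ne_zero {F : Type*} [Field F] (φ : GaussianInt →+* F) {t : GaussianInt}
    {N : ℕ} (ht : t.norm ∣ N) (hN : (N : F) ≠ 0) : φ t ≠ 0 := by
  intro h0
  obtain ⟨k, hk⟩ := ht
  have h1 : φ ((t.norm : ℤ) : GaussianInt) = 0 := by
    rw [Zsqrtd.norm_eq_mul_conj, map_mul, h0, zero_mul]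
  rw [map_intCast] at h1
  apply hN
  have h2 : ((N : ℤ) : F) = ((t.norm * k : ℤ) : F) := by rw [hk]
  rw [Int.cast_mul, h1, zero_mul] at h2
  simpa using h2

/-- The letters `x`, `y`, `c`, `x⁻¹`, `y⁻¹`, `c⁻¹` of a group. -/
def groupLetter {G : Type*} [Group G] (x y c : G) : Fin 6 → G := ![x, y, c, x⁻¹, y⁻¹, c⁻¹]

lemma groupLetter_mem {G : Type*} [Group G] {S : Set G} {x y c : G} (hx : x ∈ S)
    (hy : y ∈ S) (hc : c ∈ S) (l : Fin 6) :
    groupLetter x y c l ∈ S ∨ (groupLetter x y c l)⁻¹ ∈ S := by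
  fin_cases l <;> simp [groupLetter, hx, hy, hc]

lemma groupLetter_ne_one {G : Type*} [Group G] {x y c : G} (hx : x ≠ 1)
    (hy : y ≠ 1) (hc : c ≠ 1) (l : Fin 6) :
    groupLetter x y c l ≠ 1 := by
  fin_cases l <;> simp [groupLetter, hx, hy, hc]

namespace CocycleCoordinates

variable {G : Type*} [Group G] {F : Type*} [Field F] {φ : GaussianInt →+* F}
  {δ ε : Fin 2} {m : Fin 4} {n : Fin 2} (C : CocycleCoordinates G φ δ ε m n)

lemma pos_one : C.pos 1 = 0 :=
  NormalForm.mul_left_cancel_zero δ ε (C.pos 1) _ (by rw [← C.pos_mul, one_mul])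

lemma pos_inv (g : G) : C.pos g⁻¹ = (C.pos g).inv δ ε :=
  NormalForm.eq_inv_of_mul_eq_zero δ ε _ _ (by rw [← C.pos_mul, mul_inv_cancel, C.pos_one])

lemma cocycle_one : C.cocycle 1 = 0 := by
  have h := C.cocycle_mul 1 1
  rw [one_mul, C.pos_one, ModelElt.char_zero, map_one, one_mul] at h
  simpa using h

lemma pos_mul_of_pos_eq_zero {g : G} (hg : C.pos g = 0) (h : G) : C.pos (g * h) = C.pos h := by
  rw [C.pos_mul, hg, NormalForm.zero_mul]

lemma pos_mul_of_pos_eq_zero_right {g : G} (hg : C.pos g = 0) (h : G) :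
    C.pos (h * g) = C.pos h := by
  rw [C.pos_mul, hg, NormalForm.mul_zero]

/-- An element with the coordinates of a given model element. -/
def Represents (g : G) (x : ModelElt) : Prop := C.pos g = x.1 ∧ C.cocycle g = φ x.2

variable {C}

lemma Represents.mul {g h : G} {x y : ModelElt} (hg : C.Represents g x) (hh : C.Represents h y) :
    C.Represents (g * h) (x.mul δ ε m n y) := by
  refine ⟨by rw [C.pos_mul, hg.1, hh.1]; rfl, ?_⟩
  rw [C.cocycle_mul, hg.1, hg.2, hh.2]
  simp [ModelElt.mul]

lemma Represents.inv {g : G} {x : ModelElt} (hg : C.Represents g x) :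
    C.Represents g⁻¹ (x.inv δ ε m n) := by
  refine ⟨by rw [C.pos_inv, hg.1]; rfl, ?_⟩
  have h := C.cocycle_mul g⁻¹ g
  rw [inv_mul_cancel, C.cocycle_one, C.pos_inv, hg.1, hg.2, ← map_mul] at h
  rw [ModelElt.inv, map_neg]
  exact eq_neg_of_add_eq_zero_left h.symm

lemma represents_one : C.Represents 1 (0, 0) := ⟨C.pos_one, by simpa using C.cocycle_one⟩

lemma represents_groupLetter {x y c : G} {x' y' c' : ModelElt} (hx : C.Represents x x')
    (hy : C.Represents y y') (hc : C.Represents c c') (l : Fin 6) :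
    C.Represents (groupLetter x y c l) (modelLetter δ ε m n x' y' c' l) := by
  fin_cases l
  exacts [hx, hy, hc, hx.inv, hy.inv, hc.inv]

lemma pos_groupLetter (x y c : G) (l : Fin 6) :
    C.pos (groupLetter x y c l) = normalFormLetter δ ε (C.pos x) (C.pos y) (C.pos c) l := by
  fin_cases l
  exacts [rfl, rfl, rfl, C.pos_inv x, C.pos_inv y, C.pos_inv c]

lemma represents_prod {ι : Type*} {u : ι → G} {v : ι → ModelElt}
    (huv : ∀ l, C.Represents (u l) (v l)) (w : List ι) {g : G} {x : ModelElt}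
    (hg : C.Represents g x) :
    C.Represents (g * (w.map u).prod) (ModelElt.prodFrom δ ε m n x (w.map v)) := by
  induction w generalizing g x with
  | nil => simpa [ModelElt.prodFrom] using hg
  | cons l w ih =>
    have := ih (hg.mul (huv l))
    simpa [ModelElt.prodFrom, mul_assoc] using this

lemma pos_prod {ι : Type*} {u : ι → G} {v : ι → NormalForm} (huv : ∀ l, C.pos (u l) = v l)
    (w : List ι) (g : G) :
    C.pos (g * (w.map u).prod) = (w.map v).foldl (NormalForm.mul δ ε) (C.pos g) := by
  induction w generalizing g with
  | nil => simp
  | cons l w ih =>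
    rw [List.map_cons, List.prod_cons, ← mul_assoc, ih, C.pos_mul, huv]
    rfl

lemma map_pos_partialProds {ι : Type*} {u : ι → G} {v : ι → NormalForm}
    (huv : ∀ l, C.pos (u l) = v l) (w : List ι) (g : G) :
    (partialProds g (w.map u)).map C.pos =
      partialFolds (NormalForm.mul δ ε) (C.pos g) (w.map v) := by
  induction w generalizing g with
  | nil => rfl
  | cons l w ih =>
    rw [List.map_cons, partialProds_cons, List.map_cons, ih, C.pos_mul, huv]
    rfl

lemma forall₂_represents_partialProds {ι : Type*} {u : ι → G} {v : ι → ModelElt}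
    (huv : ∀ l, C.Represents (u l) (v l)) (w : List ι) {g : G} {x : ModelElt}
    (hg : C.Represents g x) :
    List.Forall₂ C.Represents (partialProds g (w.map u))
      (partialFolds (ModelElt.mul δ ε m n) x (w.map v)) := by
  induction w generalizing g x with
  | nil => exact List.Forall₂.nil
  | cons l w ih => exact List.Forall₂.cons hg (ih (hg.mul (huv l)))

variable {p : ℕ} [CharP F p]

/-- The character is trivial on the kernel of `pos`, so the cocycle is additive there and takes `g ^
p` to `p` times its value at `g`. -/
lemma pow_eq_one {g : G} (hg : C.pos g = 0) : g ^ p = 1 := by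
  have key : ∀ k : ℕ, C.pos (g ^ k) = 0 ∧ C.cocycle (g ^ k) = k * C.cocycle g := by
    intro k
    induction k with
    | zero => simpa using ⟨C.pos_one, C.cocycle_one⟩
    | succ k ih =>
      refine ⟨by rw [pow_succ, C.pos_mul_of_pos_eq_zero_right hg, ih.1], ?_⟩
      rw [pow_succ, C.cocycle_mul, ih.1, ih.2, ModelElt.char_zero, map_one]
      push_cast
      ring
  exact C.eq_one _ (key p).1 (by rw [(key p).2, CharP.cast_eq_zero, zero_mul])

lemma orderOf_eq (hp : p.Prime) {g : G} (hg : C.pos g = 0) (h1 : g ≠ 1) : orderOf g = p :=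
  have := Fact.mk hp
  orderOf_eq_prime (C.pow_eq_one hg) h1

variable (C) [DecidableEq G] {S : Set G}

/-- A word that is a hamiltonian cycle of the quotient and on whose product the cocycle does not
vanish gives a hamiltonian cycle. -/
theorem exists_isHamiltonianCycle_of_cocycle_ne_zero (hp : p.Prime) (hcard : Nat.card G = 16 * p)
    {u : Fin 6 → G} {v : Fin 6 → NormalForm} (huv : ∀ l, C.pos (u l) = v l)
    (huS : ∀ l, u l ∈ S ∨ (u l)⁻¹ ∈ S) (hu1 : ∀ l, u l ≠ 1) {w : List (Fin 6)}
    (hlen : w.length = 16) (hw : IsQuotientCycle δ ε (w.map v))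
    (hne : C.cocycle (w.map u).prod ≠ 0) :
    ∃ (v : G) (W : (SimpleGraph.mulCayley S).Walk v v), W.IsHamiltonianCycle := by
  have hpos : C.pos (w.map u).prod = 0 := by
    have := pos_prod huv w (1 : G)
    rwa [one_mul, C.pos_one, hw.2] at this
  have hone : (w.map u).prod ≠ 1 := fun h => hne (by rw [h, C.cocycle_one])
  have hord := C.orderOf_eq hp hpos hone
  have hmem : ∀ s ∈ (List.replicate (orderOf (w.map u).prod) (w.map u)).flatten, ∃ l, s = u l := by
    intro s hs
    obtain ⟨W, hW, hs⟩ := List.mem_flatten.1 hs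
    rw [List.eq_of_mem_replicate hW] at hs
    obtain ⟨l, _, rfl⟩ := List.mem_map.1 hs
    exact ⟨l, rfl⟩
  refine exists_isHamiltonianCycle_of_word
    (List.replicate (orderOf (w.map u).prod) (w.map u)).flatten ?_ ?_
    (nodup_partialProds_replicate_flatten _ C.pos ?_ (C.pos_mul_of_pos_eq_zero hpos)) ?_ ?_ ?_
  · rintro s hs
    obtain ⟨l, rfl⟩ := hmem s hs
    exact huS l
  · rintro s hs
    obtain ⟨l, rfl⟩ := hmem s hs
    exact hu1 l
  · rw [map_pos_partialProds huv, C.pos_one]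
    exact hw.1
  · simp [List.prod_flatten, pow_orderOf_eq_one]
  · simp [List.length_flatten, hord, hcard, hlen, mul_comm]
  · have := hp.two_le
    omega

/-- If the third generator lies in the kernel of `pos`, then each of its cosets can be visited
completely before the next letter of the word is used. -/
theorem exists_isHamiltonianCycle_of_interleave (hp : p.Prime) (hcard : Nat.card G = 16 * p)
    {u : Fin 6 → G} {v : Fin 6 → NormalForm} (huv : ∀ l, C.pos (u l) = v l)
    (huS : ∀ l, u l ∈ S ∨ (u l)⁻¹ ∈ S) (hu1 : ∀ l, u l ≠ 1) {w : List (Fin 6)}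
    (hlen : w.length = 16) (hw : IsQuotientCycle δ ε (w.map v)) (l₀ : Fin 6) (hl₀ : v l₀ = 0)
    (hprod : (w.map fun l => (u l₀)⁻¹ * u l).prod = 1) :
    ∃ (v : G) (W : (SimpleGraph.mulCayley S).Walk v v), W.IsHamiltonianCycle := by
  have hpos : C.pos (u l₀) = 0 := by rw [huv, hl₀]
  have hpos' : C.pos (u l₀)⁻¹ = 0 := by
    have := C.pos_mul_of_pos_eq_zero hpos (u l₀)⁻¹
    rwa [mul_inv_cancel, C.pos_one, eq_comm] at this
  have hord := C.orderOf_eq hp hpos (hu1 l₀)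
  set c := u l₀ with hc
  have hcinv : c ^ (orderOf c - 1) = c⁻¹ := by
    rw [eq_inv_iff_mul_eq_one, ← pow_succ, Nat.sub_add_cancel (by rw [hord]; exact hp.pos),
      pow_orderOf_eq_one]
  have hmem : ∀ s ∈ (w.map u).flatMap (fun s => List.replicate (orderOf c - 1) c ++ [s]),
      ∃ l, s = u l := by
    intro s hs
    obtain ⟨t, ht, hs⟩ := List.mem_flatMap.1 hs
    rcases List.mem_append.1 hs with hs | hs
    · exact ⟨l₀, List.eq_of_mem_replicate hs⟩
    · obtain ⟨l, _, rfl⟩ := List.mem_map.1 ht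
      exact ⟨l, by simpa using hs⟩
  refine exists_isHamiltonianCycle_of_word
    ((w.map u).flatMap fun s => List.replicate (orderOf c - 1) c ++ [s]) ?_ ?_
    (nodup_partialProds_flatMap_replicate c (by rw [hord]; exact hp.pos) _ C.pos
      (C.pos_mul_of_pos_eq_zero_right hpos) ?_) ?_ ?_ ?_
  · rintro s hs
    obtain ⟨l, rfl⟩ := hmem s hs
    exact huS l
  · rintro s hs
    obtain ⟨l, rfl⟩ := hmem s hs
    exact hu1 l
  · rw [List.map_map, map_pos_partialProds (v := v)
      (fun l => by simp [C.pos_mul_of_pos_eq_zero hpos', huv]), C.pos_one]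
    exact hw.1
  · rw [← hprod]
    clear hlen hw hprod hmem
    induction w with
    | nil => rfl
    | cons l w ih => simp [ih, hcinv, mul_assoc]
  · have hconst : (fun s : G => (List.replicate (orderOf c - 1) c ++ [s]).length) = fun _ => p := by
      funext s
      simp [hord, Nat.sub_add_cancel hp.one_le]
    rw [List.length_flatMap, hconst, List.map_const', List.sum_replicate, List.length_map, hlen,
      hcard, smul_eq_mul]
  · have := hp.two_le
    omega

/-- The hamiltonian cycle `(x ^ 5 * y) ^ 8` of the group of order 48 that is not reached by the
factor group lemma. -/
theorem exists_isHamiltonianCycle_exceptional [CharP F 3] (hcard : Nat.card G = 16 * 3)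
    {u : Fin 6 → G} (C : CocycleCoordinates G φ 1 0 0 1)
    (hu : ∀ l, C.Represents (u l) (twoGeneratorLetter 1 0 0 0 l))
    (huS : ∀ l, u l ∈ S ∨ (u l)⁻¹ ∈ S) (hu1 : ∀ l, u l ≠ 1) :
    ∃ (v : G) (W : (SimpleGraph.mulCayley S).Walk v v), W.IsHamiltonianCycle := by
  refine exists_isHamiltonianCycle_of_word (exceptionalWord.map u) ?_ ?_ ?_ ?_ ?_ ?_
  · rintro s hs
    obtain ⟨l, _, rfl⟩ := List.mem_map.1 hs
    exact huS l
  · rintro s hs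
    obtain ⟨l, _, rfl⟩ := List.mem_map.1 hs
    exact hu1 l
  · have h := forall₂_represents_partialProds hu exceptionalWord represents_one
    have hmap : ∀ (l : List G) (l' : List ModelElt), List.Forall₂ C.Represents l l' →
        l.map (fun g => (C.pos g, C.cocycle g)) = l'.map fun x => (x.1, φ x.2) := by
      intro l l' hl
      induction hl with
      | nil => rfl
      | cons h _ ih => rw [List.map_cons, List.map_cons, ih, h.1, h.2]
    refine List.Nodup.of_map (fun g => (C.pos g, C.cocycle g)) ?_
    rw [hmap _ _ h]
    refine List.Nodup.map_on (fun x hx y hy hxy => ?_) (exceptionalWord_nodup.of_map _)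
    refine List.inj_on_of_nodup_map exceptionalWord_nodup hx hy (Prod.ext (Prod.ext_iff.1 hxy).1 ?_)
    have hφ : ∀ z : GaussianInt, z.im = 0 → φ z = (z.re : F) := by
      intro z hz
      rw [← map_intCast φ]
      congr 1
      exact Zsqrtd.ext rfl hz
    have h2 := (Prod.ext_iff.1 hxy).2
    simp only at h2
    rw [hφ _ (im_partialProds_exceptionalWord x hx), hφ _ (im_partialProds_exceptionalWord y hy),
      CharP.intCast_eq_intCast F 3] at h2
    exact h2
  · have h := represents_prod hu exceptionalWord represents_one
    rw [prodFrom_exceptionalWord, one_mul] at h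
    exact C.eq_one _ h.1 (by simpa using h.2)
  · simp [exceptionalWord, hcard]
  · omega

lemma length_decodeWord (N : ℕ) : (decodeWord N).length = 16 := by
  simp [decodeWord]

lemma length_twoGeneratorWord (δ ε t : Fin 2) (k : Fin 5) :
    (twoGeneratorWord δ ε t k).length = 16 :=
  length_decodeWord _

lemma length_threeGeneratorWord (δ ε t : Fin 2) (q : NormalForm) :
    (threeGeneratorWord δ ε t q).length = 16 :=
  length_decodeWord _

/-- Two generators whose cocycle values are `1` and `0`. -/
theorem exists_isHamiltonianCycle_of_two_generators (hp : p.Prime) (hodd : Odd p)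
    (hcard : Nat.card G = 16 * p) {t : Fin 2} {k : Fin 5}
    (C : CocycleCoordinates G φ δ ε (charPair k).1 (charPair k).2) {x y : G} (hx : x ∈ S)
    (hy : y ∈ S) (hxpos : C.pos x = (1, 0, 0)) (hypos : C.pos y = (Fin.castLE (by omega) t, 1, 0))
    (hxc : C.cocycle x = if (charPair k).1 = 0 then 1 else 0)
    (hyc : C.cocycle y = if (charPair k).1 = 0 then 0 else 1) :
    ∃ (v : G) (W : (SimpleGraph.mulCayley S).Walk v v), W.IsHamiltonianCycle := by
  have hu : ∀ l, C.Represents (groupLetter x y x l) (twoGeneratorLetter δ ε t k l) :=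
    represents_groupLetter ⟨hxpos, by rw [hxc]; split_ifs <;> simp⟩
      ⟨hypos, by rw [hyc]; split_ifs <;> simp⟩ ⟨hxpos, by rw [hxc]; split_ifs <;> simp⟩
  have hx1 : x ≠ 1 := by
    rintro rfl
    rw [C.pos_one] at hxpos
    exact absurd (congrArg Prod.fst hxpos) (by decide)
  have hy1 : y ≠ 1 := by
    rintro rfl
    rw [C.pos_one] at hypos
    exact absurd (congrArg (fun v => v.2.1) hypos) (show ¬(0 : Fin 2) = 1 by decide)
  have huS := groupLetter_mem hx hy hx
  have hu1 := groupLetter_ne_one hx1 hy1 hx1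
  have h2 : (2 : F) ≠ 0 := by
    intro h
    have := (CharP.cast_eq_zero_iff F p 2).1 (by exact_mod_cast h)
    have := (Nat.prime_dvd_prime_iff_eq hp Nat.prime_two).1 this
    subst this
    exact absurd hodd (by decide)
  -- The only case in which the tabulated product can have cocycle zero.
  by_cases hex : (δ, ε, t, k) = (1, 0, 0, 0) ∧ p = 3
  · obtain ⟨h, rfl⟩ := hex
    obtain ⟨rfl, rfl, rfl, rfl⟩ : δ = 1 ∧ ε = 0 ∧ t = 0 ∧ k = 0 := by simpa [Prod.ext_iff] using h
    exact exists_isHamiltonianCycle_exceptional hcard C hu huS hu1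
  · refine C.exists_isHamiltonianCycle_of_cocycle_ne_zero hp hcard (v := normalFormLetter δ ε
      (1, 0, 0) (Fin.castLE (by omega) t, 1, 0) (1, 0, 0)) (fun l => ?_) huS hu1
      (length_twoGeneratorWord δ ε t k) (twoGeneratorWord_isQuotientCycle δ ε t k) ?_
    · rw [pos_groupLetter, hxpos, hypos]
    · have h := (represents_prod hu (twoGeneratorWord δ ε t k) represents_one).2
      rw [one_mul] at h
      rw [h]
      have hn := norm_twoGeneratorWord δ ε t k
      split_ifs at hn with hif
      · refine map_gaussianInt_ne_zero φ (N := 144) (by exact_mod_cast hn) ?_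
        have h3 : (3 : F) ≠ 0 := by
          intro h
          have := (CharP.cast_eq_zero_iff F p 3).1 (by exact_mod_cast h)
          exact hex ⟨hif, (Nat.prime_dvd_prime_iff_eq hp Nat.prime_three).1 this⟩
        have : ((144 : ℕ) : F) = 2 ^ 4 * 3 ^ 2 := by norm_num
        rw [this]
        exact mul_ne_zero (pow_ne_zero _ h2) (pow_ne_zero _ h3)
      · refine map_gaussianInt_ne_zero φ (N := 1024) (by exact_mod_cast hn) ?_
        have : ((1024 : ℕ) : F) = 2 ^ 10 := by norm_num
        rw [this]
        exact pow_ne_zero _ h2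

/-- Three generators, the cocycle being nonzero on the third only. -/
theorem exists_isHamiltonianCycle_of_three_generators (hp : p.Prime) (hodd : Odd p)
    (hcard : Nat.card G = 16 * p) {t : Fin 2} {k : Fin 5}
    (C : CocycleCoordinates G φ δ ε (charPair k).1 (charPair k).2) {x y c : G} (hx : x ∈ S)
    (hy : y ∈ S) (hc : c ∈ S) (hxpos : C.pos x = (1, 0, 0))
    (hypos : C.pos y = (Fin.castLE (by omega) t, 1, 0)) (hxc : C.cocycle x = 0)
    (hyc : C.cocycle y = 0) (hcc : C.cocycle c = 1) :
    ∃ (v : G) (W : (SimpleGraph.mulCayley S).Walk v v), W.IsHamiltonianCycle := by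
  have hu : ∀ l, C.Represents (groupLetter x y c l) (threeGeneratorLetter δ ε t (C.pos c) k l) :=
    represents_groupLetter ⟨hxpos, by simp [hxc]⟩ ⟨hypos, by simp [hyc]⟩ ⟨rfl, by simp [hcc]⟩
  have hx1 : x ≠ 1 := by
    rintro rfl
    rw [C.pos_one] at hxpos
    exact absurd (congrArg Prod.fst hxpos) (by decide)
  have hy1 : y ≠ 1 := by
    rintro rfl
    rw [C.pos_one] at hypos
    exact absurd (congrArg (fun v => v.2.1) hypos) (show ¬(0 : Fin 2) = 1 by decide)
  have hc1 : c ≠ 1 := by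
    rintro rfl
    rw [C.cocycle_one] at hcc
    exact zero_ne_one hcc
  have huS := groupLetter_mem hx hy hc
  have hu1 := groupLetter_ne_one hx1 hy1 hc1
  have hv : ∀ l, C.pos (groupLetter x y c l) = normalFormLetter δ ε
      (1, 0, 0) (Fin.castLE (by omega) t, 1, 0) (C.pos c) l := fun l => by
    rw [pos_groupLetter, hxpos, hypos]
  have h2 : (2 : F) ≠ 0 := by
    intro h
    have := (CharP.cast_eq_zero_iff F p 2).1 (by exact_mod_cast h)
    have := (Nat.prime_dvd_prime_iff_eq hp Nat.prime_two).1 this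
    subst this
    exact absurd hodd (by decide)
  by_cases hq : C.pos c = 0
  · rw [hq] at hu hv
    refine C.exists_isHamiltonianCycle_of_interleave hp hcard hv huS hu1
      (length_threeGeneratorWord δ ε t 0) (threeGeneratorWord_isQuotientCycle δ ε t 0) 2 rfl ?_
    -- Letter 5 is `c⁻¹`, so the word being evaluated has letters `c⁻¹ * u l`.
    have h := represents_prod (u := fun l => (groupLetter x y c 2)⁻¹ * groupLetter x y c l)
      (fun l => (hu 5).mul (hu l)) (threeGeneratorWord δ ε t 0) represents_one
    rw [prodFrom_interleave_threeGeneratorWord, one_mul] at h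
    exact C.eq_one _ h.1 (by rw [h.2]; exact map_zero φ)
  · refine C.exists_isHamiltonianCycle_of_cocycle_ne_zero hp hcard hv huS hu1
      (length_threeGeneratorWord δ ε t _) (threeGeneratorWord_isQuotientCycle δ ε t (C.pos c)) ?_
    have h := (represents_prod hu (threeGeneratorWord δ ε t (C.pos c)) represents_one).2
    rw [one_mul] at h
    rw [h]
    have hn := norm_threeGeneratorWord δ ε t (C.pos c) hq k
    refine map_gaussianInt_ne_zero φ (N := 1024) (by exact_mod_cast hn) ?_
    have : ((1024 : ℕ) : F) = 2 ^ 10 := by norm_num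
    rw [this]
    exact pow_ne_zero _ h2

end CocycleCoordinates

end Coordinates

/-! ### Identification of `G/P` with a group of normal forms -/

section NormalFormExistence

namespace NormalForm

/-- The element `a ^ i * b ^ j * z ^ k` with normal form `(i, j, k)`. -/
def eval {H : Type*} [Group H] (a b z : H) (x : NormalForm) : H :=
  a ^ x.1.val * b ^ x.2.1.val * z ^ x.2.2.val

lemma eval_mul {H : Type*} [Group H] {a b z : H} {δ ε : Fin 2} (ha : a ^ 4 = z ^ δ.val)
    (hb : b ^ 2 = z ^ ε.val) (hz : z ^ 2 = 1) (hba : b * a = a * b * z) (hza : Commute z a)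
    (hzb : Commute z b) (x y : NormalForm) :
    eval a b z (x.mul δ ε y) = eval a b z x * eval a b z y := by
  have hmod : ∀ n : ℕ, z ^ (Fin.ofNat 2 n).val = z ^ n := fun n =>
    (pow_eq_pow_mod n hz).symm
  have hadd : ∀ k l : Fin 2, z ^ (k + l).val = z ^ (k.val + l.val) := fun k l =>
    (pow_eq_pow_mod _ hz).symm
  have ha4 : ∀ i i' : Fin 4, a ^ (i.val + i'.val) =
      a ^ (i + i').val * z ^ (δ.val * ((i.val + i'.val) / 4)) := fun i i' => by
    rw [pow_mul, ← ha, ← pow_mul, ← pow_add, Fin.val_add, Nat.mod_add_div]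
  have hb2 : ∀ j j' : Fin 2, b ^ (j.val + j'.val) =
      b ^ (j + j').val * z ^ (ε.val * ((j.val + j'.val) / 2)) := fun j j' => by
    rw [pow_mul, ← hb, ← pow_mul, ← pow_add, Fin.val_add, Nat.mod_add_div]
  have hb1 : ∀ i : ℕ, b * a ^ i = a ^ i * b * z ^ i := by
    intro i
    induction i with
    | zero => simp
    | succ i ih =>
      calc b * a ^ (i + 1) = b * a ^ i * a := by rw [pow_succ, mul_assoc]
        _ = a ^ i * b * (z ^ i * a) := by rw [ih]; group
        _ = a ^ i * (b * a) * z ^ i := by rw [(hza.pow_left i).eq]; group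
        _ = a ^ (i + 1) * b * z ^ (i + 1) := by rw [hba]; group
  have hbj : ∀ i j : ℕ, b ^ j * a ^ i = a ^ i * b ^ j * z ^ (j * i) := by
    intro i j
    induction j with
    | zero => simp
    | succ j ih =>
      calc b ^ (j + 1) * a ^ i = b ^ j * (b * a ^ i) := by rw [pow_succ, mul_assoc]
        _ = b ^ j * a ^ i * b * z ^ i := by rw [hb1]; group
        _ = a ^ i * b ^ j * (z ^ (j * i) * b) * z ^ i := by rw [ih]; group
        _ = a ^ i * b ^ (j + 1) * z ^ ((j + 1) * i) := by
          rw [(hzb.pow_left _).eq, Nat.succ_mul, pow_add z, pow_succ b]; group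
  obtain ⟨i, j, k⟩ := x
  obtain ⟨i', j', k'⟩ := y
  simp only [eval, mul]
  rw [hadd, pow_add, hmod, hadd, pow_add, pow_add, pow_add]
  have c1 : ∀ n l : ℕ, Commute (z ^ n) (a ^ l) := fun n l => hza.pow_pow n l
  have c2 : ∀ n l : ℕ, Commute (z ^ n) (b ^ l) := fun n l => hzb.pow_pow n l
  symm
  calc a ^ i.val * b ^ j.val * z ^ k.val * (a ^ i'.val * b ^ j'.val * z ^ k'.val)
      = a ^ i.val * b ^ j.val * (z ^ k.val * a ^ i'.val) * b ^ j'.val * z ^ k'.val := by group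
    _ = a ^ i.val * (b ^ j.val * a ^ i'.val) * (z ^ k.val * b ^ j'.val) * z ^ k'.val := by
        rw [(c1 _ _).eq]; group
    _ = a ^ i.val * a ^ i'.val * b ^ j.val * (z ^ (j.val * i'.val) * b ^ j'.val) * z ^ k.val *
          z ^ k'.val := by rw [hbj, (c2 _ _).eq]; group
    _ = a ^ (i.val + i'.val) * b ^ (j.val + j'.val) * z ^ (j.val * i'.val) * z ^ k.val *
          z ^ k'.val := by rw [(c2 _ _).eq, pow_add, pow_add]; group
    _ = a ^ (i + i').val * (z ^ (δ.val * ((i.val + i'.val) / 4)) * b ^ (j + j').val) *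
          z ^ (ε.val * ((j.val + j'.val) / 2)) * z ^ (j.val * i'.val) * z ^ k.val *
          z ^ k'.val := by rw [ha4, hb2]; group
    _ = _ := by
      rw [(c2 _ _).eq]
      simp only [mul_assoc, ← pow_add]
      congr 3
      ring

end NormalForm

variable {G : Type*} [Group G]

/-- Elements of the commutator subgroup are, modulo a subgroup of index two in it, powers of any
element outside that subgroup. -/
lemma exists_fin_two_pow {P N : Subgroup G} [P.Normal] (hrel : P.relIndex N = 2) {z : G}
    (hz : z ∈ N) (hzP : z ∉ P) {g : G} (hg : g ∈ N) :
    ∃ k : Fin 2, (g : G ⧸ P) = (z : G ⧸ P) ^ k.val := by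
  by_cases hgP : g ∈ P
  · exact ⟨0, by simpa using hgP⟩
  · refine ⟨1, ?_⟩
    have := (Subgroup.mul_mem_iff_of_index_two (H := P.subgroupOf N) hrel
      (a := ⟨z⁻¹, N.inv_mem hz⟩) (b := ⟨g, hg⟩)).2 (by simp [Subgroup.mem_subgroupOf, hzP, hgP])
    rw [Subgroup.mem_subgroupOf] at this
    simpa using (QuotientGroup.eq.2 this).symm

/-- A conjugate of `z` lies in `N` but, by normality, not in `P`; only one such coset of `P` exists.
-/
lemma commute_mk_of_relIndex_eq_two {P N : Subgroup G} [P.Normal] [N.Normal]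
    (hrel : P.relIndex N = 2) {z : G} (hz : z ∈ N) (hzP : z ∉ P) (g : G) :
    Commute (z : G ⧸ P) (g : G ⧸ P) := by
  obtain ⟨k, hk⟩ := exists_fin_two_pow hrel hz hzP
    (show g * z * g⁻¹ ∈ N from Subgroup.Normal.conj_mem inferInstance z hz g)
  fin_cases k
  · exfalso
    simp only [pow_zero, QuotientGroup.eq_one_iff] at hk
    apply hzP
    have := Subgroup.Normal.conj_mem (inferInstance : P.Normal) _ hk g⁻¹
    simpa [mul_assoc] using this
  · simp only [pow_one, QuotientGroup.mk_mul, QuotientGroup.mk_inv] at hk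
    rw [mul_inv_eq_iff_eq_mul] at hk
    exact hk.symm

/-- Here `v` has order 4 and `w` is an involution outside its powers, so the two cyclic groups meet
trivially and their product has all 8 elements. -/
lemma exists_eq_pow_mul_pow : ∀ v w x : Multiplicative (ZMod 4 × ZMod 2), v ^ 2 ≠ 1 →
    (∀ i : Fin 4, w ≠ v ^ i.val) → w ^ 2 = 1 →
    ∃ (i : Fin 4) (j : Fin 2), x = v ^ i.val * w ^ j.val := by
  decide +kernel

/-- The quotient by `P` is one of the groups of normal forms. -/
theorem exists_normalForm (P : Subgroup G) [P.Normal] (hcard : Nat.card (G ⧸ P) = 16)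
    (θ : G →* Multiplicative (ZMod 4 × ZMod 2)) (hker : θ.ker = commutator G)
    (hrel : P.relIndex (commutator G) = 2) (a b : G) (ha : θ a ^ 2 ≠ 1)
    (hb : ∀ i : Fin 4, θ b ≠ θ a ^ i.val) (hb2 : θ b ^ 2 = 1) :
    ∃ (δ ε : Fin 2) (z : G) (pos : G → NormalForm), z ∈ commutator G ∧
      (∀ g h, pos (g * h) = (pos g).mul δ ε (pos h)) ∧ (∀ g, pos g = 0 ↔ g ∈ P) ∧
      pos a = (1, 0, 0) ∧ pos b = (0, 1, 0) ∧
      ∀ g, (NormalForm.eval a b z (pos g))⁻¹ * g ∈ P := by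
  obtain ⟨z, hz, hzP⟩ : ∃ z ∈ commutator G, z ∉ P := by
    by_contra! h
    have := Subgroup.relIndex_eq_one.2 h
    omega
  have hθ : ∀ g, θ g = 1 → ∃ k : Fin 2, (g : G ⧸ P) = (z : G ⧸ P) ^ k.val := fun g hg =>
    exists_fin_two_pow hrel hz hzP (by rw [← hker]; exact hg)
  have hcomm := commute_mk_of_relIndex_eq_two hrel hz hzP
  have hV4 : ∀ v : Multiplicative (ZMod 4 × ZMod 2), v ^ 4 = 1 := by decide
  obtain ⟨δ, hδ⟩ := hθ (a ^ 4) (by rw [map_pow, hV4])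
  obtain ⟨ε, hε⟩ := hθ (b ^ 2) (by rw [map_pow, hb2])
  have hz2 : (z : G ⧸ P) ^ 2 = 1 := by
    have := (Subgroup.mul_mem_iff_of_index_two (H := P.subgroupOf (commutator G)) hrel
      (a := ⟨z, hz⟩) (b := ⟨z, hz⟩)).2 Iff.rfl
    rw [Subgroup.mem_subgroupOf] at this
    rw [← QuotientGroup.mk_pow, QuotientGroup.eq_one_iff, sq]
    exact this
  obtain ⟨κ, hκ⟩ := hθ ((a * b)⁻¹ * (b * a)) (by
    rw [map_mul, map_inv, map_mul, map_mul, inv_mul_eq_one, mul_comm])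
  have hsurj : ∀ g : G, ∃ x : NormalForm, NormalForm.eval (a : G ⧸ P) (b : G ⧸ P) z x = g := by
    intro g
    obtain ⟨i, j, hij⟩ := exists_eq_pow_mul_pow _ _ (θ g) ha hb hb2
    obtain ⟨k, hk⟩ := hθ ((a ^ i.val * b ^ j.val)⁻¹ * g) (by simp [hij])
    refine ⟨(i, j, k), ?_⟩
    rw [NormalForm.eval, ← hk]
    simp only [QuotientGroup.mk_mul, QuotientGroup.mk_inv, QuotientGroup.mk_pow]
    group
  -- If `a` and `b` commuted modulo `P`, then `G/P`, generated by `a`, `b` and the central `z`,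
  -- would be abelian, forcing `G' ≤ P`.
  have hκ1 : κ = 1 := by
    by_contra hne
    have hκ0 : κ = 0 := by omega
    rw [hκ0] at hκ
    have hab : Commute (a : G ⧸ P) (b : G ⧸ P) := by
      have : ((a : G ⧸ P) * b)⁻¹ * (b * a) = 1 := by simpa using hκ
      rw [inv_mul_eq_one] at this
      exact this
    have hall : ∀ g h : G ⧸ P, Commute g h := by
      have hgen : ∀ (u : G ⧸ P), Commute u a → Commute u b → Commute u z → ∀ g : G,
          Commute u (g : G ⧸ P) := by
        intro u h1 h2 h3 g
        obtain ⟨x, hx⟩ := hsurj g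
        rw [← hx]
        exact ((h1.pow_right _).mul_right (h2.pow_right _)).mul_right (h3.pow_right _)
      intro g h
      induction g using QuotientGroup.induction_on with | H g => ?_
      induction h using QuotientGroup.induction_on with | H h => ?_
      exact hgen g (hgen a (Commute.refl _) hab (hcomm a).symm g).symm
        (hgen b hab.symm (Commute.refl _) (hcomm b).symm g).symm (hcomm g).symm h
    apply hzP
    have hle : commutator G ≤ P := by
      rw [commutator_def, Subgroup.commutator_le]
      intro g _ h _
      rw [← QuotientGroup.eq_one_iff, commutatorElement_def]
      have := (hall (g : G ⧸ P) (h : G ⧸ P)).eq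
      simp only [QuotientGroup.mk_mul, QuotientGroup.mk_inv]
      rw [this]
      group
    exact hle hz
  rw [hκ1] at hκ
  have hba : (b : G ⧸ P) * a = a * b * z := by
    simp only [Fin.val_one, pow_one, QuotientGroup.mk_mul, QuotientGroup.mk_inv] at hκ
    rw [← hκ]
    group
  have hmul := NormalForm.eval_mul (δ := δ) (ε := ε) (by simpa using hδ) (by simpa using hε) hz2 hba
    (hcomm a) (hcomm b)
  have : Finite (G ⧸ P) := Nat.finite_of_card_ne_zero (by omega)
  have := Fintype.ofFinite (G ⧸ P)
  have hbij : Function.Bijective (NormalForm.eval (a : G ⧸ P) (b : G ⧸ P) z) := by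
    rw [Fintype.bijective_iff_surjective_and_card]
    refine ⟨fun g => ?_, ?_⟩
    · induction g using QuotientGroup.induction_on with | H g => exact hsurj g
    · rw [← Nat.card_eq_fintype_card (α := G ⧸ P), hcard]
      rfl
  have hone : NormalForm.eval (a : G ⧸ P) (b : G ⧸ P) z 0 = 1 := by simp [NormalForm.eval]
  let e := Equiv.ofBijective _ hbij
  have he : ∀ g : G ⧸ P, NormalForm.eval (a : G ⧸ P) (b : G ⧸ P) z (e.symm g) = g :=
    e.apply_symm_apply
  refine ⟨δ, ε, z, fun g => e.symm g, hz, fun g h => ?_, fun g => ?_, ?_, ?_, fun g => ?_⟩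
  · apply hbij.1
    rw [hmul, he, he, he]
    rfl
  · rw [← QuotientGroup.eq_one_iff, ← hbij.1.eq_iff, he, hone]
  · apply hbij.1
    rw [he]
    simp [NormalForm.eval]
  · apply hbij.1
    rw [he]
    simp [NormalForm.eval]
  · rw [← QuotientGroup.eq]
    simpa [NormalForm.eval] using he g

end NormalFormExistence

/-! ### The action on `P` and its crossed homomorphism -/

section CocycleExistence

variable {G : Type*} [Group G]

/-- A normal subgroup of prime order `p` that has a complement is the kernel of the action on
itself together with a crossed homomorphism. -/
theorem exists_cocycle (p : ℕ) (hp : p.Prime) (P : Subgroup G) [P.Normal] (hP : Nat.card P = p)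
    (hcop : p.Coprime P.index) :
    ∃ (χ : G →* ZMod p) (τ : G → ZMod p), (∀ g h, τ (g * h) = τ g + χ g * τ h) ∧
      (∀ x ∈ P, χ x = 1) ∧ ∀ x ∈ P, τ x = 0 → x = 1 := by
  have := Fact.mk hp
  -- Schur–Zassenhaus; `τ` will be the `P`-component of an element of `P K`.
  obtain ⟨K, hK⟩ := Subgroup.exists_right_complement'_of_coprime (N := P) (by rwa [hP])
  let e : P ≃* Multiplicative (ZMod p) := mulEquivOfPrimeCardEq hP (by simp)
  let ψ : P → ZMod p := fun x => (e x).toAdd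
  have hψmul : ∀ x y, ψ (x * y) = ψ x + ψ y := fun x y => by simp [ψ]
  have hψinj : Function.Injective ψ := Multiplicative.toAdd.injective.comp e.injective
  let u : P := e.symm (Multiplicative.ofAdd 1)
  have hψu : ψ u = 1 := by simp [ψ, u]
  have hψpow : ∀ (n : ℕ) (x : P), ψ (x ^ n) = n * ψ x := fun n x => by simp [ψ]
  have hu : ∀ x : P, x = u ^ (ψ x).val := fun x => hψinj (by
    rw [hψpow, hψu, mul_one, ZMod.natCast_val, ZMod.cast_id])
  -- An endomorphism of the cyclic group `P` is multiplication by the image of the generator `u`;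
  -- for conjugation by `g` this scalar is `χ g`.
  have hconj : ∀ (g : G) (x : P), ψ (MulAut.conjNormal g x) =
      ψ (MulAut.conjNormal g u) * ψ x := fun g x => by
    conv_lhs => rw [hu x, map_pow, hψpow]
    rw [ZMod.natCast_val, ZMod.cast_id, mul_comm]
  let χ : G →* ZMod p :=
    { toFun := fun g => ψ (MulAut.conjNormal g u)
      map_one' := by simpa using hψu
      map_mul' := fun g h => by rw [map_mul, MulAut.mul_apply, hconj] }
  have hχ : ∀ (g : G) (x : P), ψ (MulAut.conjNormal g x) = χ g * ψ x := hconj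
  have hcomm : ∀ x y : P, x * y = y * x := fun x y => hψinj (by rw [hψmul, hψmul, add_comm])
  have hχP : ∀ x ∈ P, χ x = 1 := fun x hx => by
    have h1 : MulAut.conjNormal x u = u := by
      apply Subtype.ext
      rw [MulAut.conjNormal_apply]
      have := congrArg Subtype.val (hcomm ⟨x, hx⟩ u)
      simp only [Subgroup.coe_mul] at this
      rw [this, mul_inv_cancel_right]
    change ψ (MulAut.conjNormal x u) = 1
    rw [h1, hψu]
  have hdec : ∀ g : G, ∃ x : P, ∃ k : K, g = x * k := fun g => by
    obtain ⟨⟨x, k⟩, h, _⟩ := hK.existsUnique g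
    exact ⟨x, k, h.symm⟩
  have huniq : ∀ (x x' : P) (k k' : K), (x : G) * k = x' * k' → x = x' := fun x x' k k' h => by
    have := hK.1 (a₁ := (x, k)) (a₂ := (x', k')) h
    exact (Prod.ext_iff.1 this).1
  choose f κ hf using hdec
  refine ⟨χ, fun g => ψ (f g), fun g h => ?_, hχP, fun x hx h0 => ?_⟩
  · have h1 : f (g * h) = f g * MulAut.conjNormal (κ g : G) (f h) := by
      refine huniq _ _ (κ (g * h)) (κ g * κ h) ?_
      rw [← hf (g * h)]
      conv_lhs => rw [hf g, hf h]
      simp only [Subgroup.coe_mul, MulAut.conjNormal_apply]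
      group
    -- `P` is abelian, hence acts trivially on itself, so only the `K`-component of `g` acts.
    have h2 : χ g = χ (κ g) := by
      conv_lhs => rw [hf g, map_mul, hχP _ (f g).2, one_mul]
    change ψ (f (g * h)) = ψ (f g) + χ g * ψ (f h)
    rw [h1, hψmul, hχ, h2]
  · have h1 : f x = ⟨x, hx⟩ := huniq _ _ (κ x) 1 (by rw [← hf x]; simp)
    have h2 : f x = 1 := hψinj (h0.trans (by simp [ψ]))
    rw [h1] at h2
    exact congrArg Subtype.val h2

end CocycleExistence

/-! ### Normalizing the cocycle by coboundaries and scalars -/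

section Normalization

lemma ModelElt.char_mul (δ ε : Fin 2) (m : Fin 4) (n : Fin 2) (x y : NormalForm) :
    ModelElt.char m n (x.mul δ ε y) = ModelElt.char m n x * ModelElt.char m n y := by
  have hexp : ∀ (m : Fin 4) (n : Fin 2) (i i' : Fin 4) (j j' : Fin 2),
      (m.val * (i + i').val + 2 * n.val * (j + j').val) % 4 =
        (m.val * i.val + 2 * n.val * j.val + (m.val * i'.val + 2 * n.val * j'.val)) % 4 := by
    decide
  have h4 : (⟨0, 1⟩ : GaussianInt) ^ 4 = 1 := by decide
  rw [ModelElt.char, ModelElt.char, ModelElt.char, ← pow_add, pow_eq_pow_mod _ h4,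
    pow_eq_pow_mod (NormalForm.charExp m n x + _) h4]
  exact congrArg _ (hexp m n x.1 y.1 x.2.1 y.2.1)

namespace CocycleCoordinates

variable {G : Type*} [Group G] {F : Type*} [Field F] {φ : GaussianInt →+* F}
  {δ ε : Fin 2} {m : Fin 4} {n : Fin 2} (C : CocycleCoordinates G φ δ ε m n)

/-- Changing the cocycle by a coboundary and by a factor. -/
def modify (t u : F) (hu : u ≠ 0) : CocycleCoordinates G φ δ ε m n where
  pos := C.pos
  cocycle g := u * (C.cocycle g - t * (φ (ModelElt.char m n (C.pos g)) - 1))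
  pos_mul := C.pos_mul
  cocycle_mul g h := by
    rw [C.cocycle_mul, C.pos_mul, ModelElt.char_mul, map_mul]
    ring
  eq_one g hg h0 := by
    rw [hg, ModelElt.char_zero, map_one, sub_self, mul_zero, sub_zero] at h0
    exact C.eq_one g hg ((mul_eq_zero.1 h0).resolve_left hu)

/-- A cocycle vanishing on `S` vanishes on all of `G`, contradicting its injectivity on the kernel
of `pos`. -/
lemma exists_cocycle_ne_zero {S : Set G} (hS : Subgroup.closure S = ⊤) {g₀ : G}
    (hg₀ : C.pos g₀ = 0) (hg₁ : g₀ ≠ 1) : ∃ c ∈ S, C.cocycle c ≠ 0 := by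
  by_contra! h
  apply hg₁
  refine C.eq_one g₀ hg₀ ?_
  have hmem : g₀ ∈ Subgroup.closure S := hS ▸ Subgroup.mem_top g₀
  clear hg₀ hg₁
  induction hmem using Subgroup.closure_induction with
  | mem x hx => exact h x hx
  | one => exact C.cocycle_one
  | mul x y _ _ hx hy => rw [C.cocycle_mul, hx, hy, mul_zero, add_zero]
  | inv x _ hx =>
    have h1 := C.cocycle_mul x⁻¹ x
    rw [inv_mul_cancel, C.cocycle_one, hx, mul_zero, add_zero] at h1
    exact h1.symm

/-- The cocycle can be chosen to vanish at an element on which the character is nontrivial, and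
with the value one at a given second generator or, failing that, at a third generator. -/
theorem exists_normalized {S : Set G} (hS : Subgroup.closure S = ⊤) {g₀ : G}
    (hg₀ : C.pos g₀ = 0) (hg₁ : g₀ ≠ 1) {x : G}
    (hx : φ (ModelElt.char m n (C.pos x)) ≠ 1) (y : G) :
    ∃ C' : CocycleCoordinates G φ δ ε m n, C'.pos = C.pos ∧ C'.cocycle x = 0 ∧
      (C'.cocycle y = 1 ∨ C'.cocycle y = 0 ∧ ∃ c ∈ S, C'.cocycle c = 1) := by
  -- The coboundary coefficient solves `τ x = t * (χ x - 1)`, possible because `χ x ≠ 1`.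
  set D := C.modify (C.cocycle x / (φ (ModelElt.char m n (C.pos x)) - 1)) 1 one_ne_zero with hD
  have hDx : D.cocycle x = 0 := by
    have := sub_ne_zero.2 hx
    simp only [hD, modify]
    field_simp
    ring
  have hscale : ∀ (u : F) (hu : u ≠ 0) (g : G), (D.modify 0 u hu).cocycle g = u * D.cocycle g := by
    intro u hu g
    change u * (D.cocycle g - 0 * _) = _
    rw [zero_mul, sub_zero]
  by_cases hy : D.cocycle y = 0
  · obtain ⟨c, hc, hc0⟩ := D.exists_cocycle_ne_zero hS hg₀ hg₁
    refine ⟨D.modify 0 (D.cocycle c)⁻¹ (inv_ne_zero hc0), rfl, ?_, Or.inr ⟨?_, c, hc, ?_⟩⟩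
    · rw [hscale, hDx, mul_zero]
    · rw [hscale, hy, mul_zero]
    · rw [hscale, inv_mul_cancel₀ hc0]
  · refine ⟨D.modify 0 (D.cocycle y)⁻¹ (inv_ne_zero hy), rfl, ?_, Or.inl ?_⟩
    · rw [hscale, hDx, mul_zero]
    · rw [hscale, inv_mul_cancel₀ hy]

lemma norm_char_sub_one_left : ∀ k : Fin 5, (charPair k).1 ≠ 0 →
    (ModelElt.char (charPair k).1 (charPair k).2 (1, 0, 0) - 1).norm ∣ 4 := by
  decide

lemma norm_char_sub_one_right : ∀ (k : Fin 5) (t : Fin 2), (charPair k).1 = 0 →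
    (ModelElt.char (charPair k).1 (charPair k).2 (Fin.castLE (by omega) t, 1, 0) - 1).norm ∣ 4 := by
  decide

/-- Coordinates together with two generators in standard position give a hamiltonian cycle. -/
theorem exists_isHamiltonianCycle [DecidableEq G] {S : Set G} (hS : Subgroup.closure S = ⊤)
    {p : ℕ} [CharP F p] (hp : p.Prime) (hodd : Odd p) (hcard : Nat.card G = 16 * p) {t : Fin 2}
    {k : Fin 5} (C : CocycleCoordinates G φ δ ε (charPair k).1 (charPair k).2) {x y g₀ : G}
    (hg₀ : C.pos g₀ = 0) (hg₁ : g₀ ≠ 1) (hx : x ∈ S) (hy : y ∈ S) (hxpos : C.pos x = (1, 0, 0))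
    (hypos : C.pos y = (Fin.castLE (by omega) t, 1, 0)) :
    ∃ (v : G) (W : (SimpleGraph.mulCayley S).Walk v v), W.IsHamiltonianCycle := by
  have h4 : ((4 : ℕ) : F) ≠ 0 := by
    intro h
    have h2 : p ∣ 2 ^ 2 := (CharP.cast_eq_zero_iff F p 4).1 h
    have := (Nat.prime_dvd_prime_iff_eq hp Nat.prime_two).1 (hp.dvd_of_dvd_pow h2)
    subst this
    exact absurd hodd (by decide)
  have hne : ∀ z : GaussianInt, (z - 1).norm ∣ 4 → φ z ≠ 1 := by
    intro z hz h
    refine map_gaussianInt_ne_zero φ (N := 4) (by exact_mod_cast hz) h4 ?_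
    rw [map_sub, h, map_one, sub_self]
  -- If the character is trivial at `x`, it is nontrivial at `y`, and the two generators exchange
  -- roles.
  by_cases hm : (charPair k).1 = 0
  · obtain ⟨D, hDpos, hDy, hD⟩ := C.exists_normalized hS hg₀ hg₁ (x := y)
      (by rw [hypos]; exact hne _ (norm_char_sub_one_right k t hm)) x
    rcases hD with hDx | ⟨hDx, c, hc, hDc⟩
    · exact D.exists_isHamiltonianCycle_of_two_generators hp hodd hcard hx hy (by rw [hDpos, hxpos])
        (by rw [hDpos, hypos]) (by rw [if_pos hm, hDx]) (by rw [if_pos hm, hDy])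
    · exact D.exists_isHamiltonianCycle_of_three_generators hp hodd hcard hx hy hc
        (by rw [hDpos, hxpos]) (by rw [hDpos, hypos]) hDx hDy hDc
  · obtain ⟨D, hDpos, hDx, hD⟩ := C.exists_normalized hS hg₀ hg₁ (x := x)
      (by rw [hxpos]; exact hne _ (norm_char_sub_one_left k hm)) y
    rcases hD with hDy | ⟨hDy, c, hc, hDc⟩
    · exact D.exists_isHamiltonianCycle_of_two_generators hp hodd hcard hx hy (by rw [hDpos, hxpos])
        (by rw [hDpos, hypos]) (by rw [if_neg hm, hDx]) (by rw [if_neg hm, hDy])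
    · exact D.exists_isHamiltonianCycle_of_three_generators hp hodd hcard hx hy hc
        (by rw [hDpos, hxpos]) (by rw [hDpos, hypos]) hDx hDy hDc

end CocycleCoordinates

end Normalization

/-! ### Choice of generators and construction of the coordinates -/

section Assembly

lemma NormalForm.mul_second_generator : ∀ δ ε t : Fin 2,
    NormalForm.mul δ ε (Fin.castLE (by omega) t, 0, 0) (0, 1, 0) =
      (Fin.castLE (by omega) t, 1, 0) := by
  decide

/-- When `r` has order 4 it serves as `ι` itself, so conjugate characters need no separate
treatment. -/
lemma exists_charPair {F : Type*} [Field F] [IsAlgClosed F] {r s : F} (hr : r ^ 4 = 1)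
    (hs : s ^ 2 = 1) (hrs : ¬(r = 1 ∧ s = 1)) :
    ∃ (ι : F) (k : Fin 5), ι * ι = -1 ∧ r = ι ^ (charPair k).1.val ∧
      s = ι ^ (2 * (charPair k).2.val) := by
  obtain ⟨ι, hι⟩ := IsAlgClosed.exists_pow_nat_eq (-1 : F) (n := 2) (by norm_num)
  have hι' : ι * ι = -1 := by rw [← sq, hι]
  have hr3 : r = 1 ∨ r = -1 ∨ r ^ 2 = -1 := by
    have h : (r - 1) * ((r + 1) * (r ^ 2 + 1)) = 0 := by linear_combination hr
    rcases mul_eq_zero.1 h with h | h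
    · exact Or.inl (sub_eq_zero.1 h)
    · rcases mul_eq_zero.1 h with h | h
      · exact Or.inr (Or.inl (eq_neg_of_add_eq_zero_left h))
      · exact Or.inr (Or.inr (eq_neg_of_add_eq_zero_left h))
  have hs2 : s = 1 ∨ s = -1 := mul_self_eq_one_iff.1 (by rw [← sq, hs])
  rcases hr3 with rfl | rfl | h
  · rcases hs2 with rfl | rfl
    · exact absurd ⟨rfl, rfl⟩ hrs
    · exact ⟨ι, 0, hι', by simp [charPair], by simp [charPair, hι]⟩
  · rcases hs2 with rfl | rfl
    · exact ⟨ι, 1, hι', by simp [charPair, hι], by simp [charPair]⟩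
    · exact ⟨ι, 2, hι', by simp [charPair, hι], by simp [charPair, hι]⟩
  · rcases hs2 with rfl | rfl
    · exact ⟨r, 3, by rw [← sq, h], by simp [charPair], by simp [charPair]⟩
    · exact ⟨r, 4, by rw [← sq, h], by simp [charPair], by simp [charPair, h]⟩

variable {G : Type*} [Group G]

/-- A generating set contains two elements that generate `ℤ/4 × ℤ/2` modulo the kernel, the first
of which has order four there. -/
lemma exists_generators {S : Set G} (hS : Subgroup.closure S = ⊤)
    (θ : G →* Multiplicative (ZMod 4 × ZMod 2)) (hθ : Function.Surjective θ) :
    ∃ a ∈ S, ∃ y ∈ S, θ a ^ 2 ≠ 1 ∧ ∀ i : Fin 4, θ y ≠ θ a ^ i.val := by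
  have key : ∀ H : Subgroup (Multiplicative (ZMod 4 × ZMod 2)), (∃ v, v ∉ H) →
      ∃ a ∈ S, θ a ∉ H := by
    rintro H ⟨v, hv⟩
    by_contra! h
    obtain ⟨g, rfl⟩ := hθ v
    have hle : Subgroup.closure S ≤ H.comap θ := (Subgroup.closure_le _).2 h
    rw [hS] at hle
    exact hv (hle (Subgroup.mem_top g))
  -- The elements of order at most 2 form a proper subgroup, since `(1, 0)` has order 4.
  obtain ⟨a, ha, ha2⟩ := key (powMonoidHom 2).ker ⟨Multiplicative.ofAdd (1, 0), by
    rw [MonoidHom.mem_ker, powMonoidHom_apply]; decide⟩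
  have hcyc : ∀ v : Multiplicative (ZMod 4 × ZMod 2), ∃ w, ∀ i : Fin 4, w ≠ v ^ i.val := by decide
  have h4 : ∀ v : Multiplicative (ZMod 4 × ZMod 2), v ^ 4 = 1 := by decide
  obtain ⟨w, hw⟩ := hcyc (θ a)
  -- The group is not cyclic, so the powers of `θ a` form a proper subgroup as well.
  obtain ⟨y, hy, hya⟩ := key (Subgroup.zpowers (θ a)) ⟨w, fun hmem => by
    obtain ⟨n, hn⟩ := Subgroup.mem_zpowers_iff.1 hmem
    have hmod := zpow_mod_orderOf (θ a) n
    have hdvd : (orderOf (θ a) : ℤ) ∣ 4 := by exact_mod_cast orderOf_dvd_of_pow_eq_one (h4 (θ a))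
    have h1 : θ a ^ (n % 4) = θ a ^ n := by
      rw [← zpow_mod_orderOf, Int.emod_emod_of_dvd _ hdvd, zpow_mod_orderOf]
    refine hw ⟨(n % 4).toNat, by omega⟩ ?_
    rw [← hn, ← h1, ← zpow_natCast]
    congr 1
    exact (Int.toNat_of_nonneg (by omega)).symm⟩
  refine ⟨a, ha, y, hy, ha2, fun i h => hya ?_⟩
  rw [h]
  exact pow_mem (Subgroup.mem_zpowers _) _

/-- The group has only one nontrivial square, so `v ^ 2 = w ^ 2`. -/
lemma sq_inv_mul_eq_one : ∀ v w : Multiplicative (ZMod 4 × ZMod 2), v ^ 2 ≠ 1 →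
    (∀ i : Fin 4, w ≠ v ^ i.val) → w ^ 2 ≠ 1 →
    (v⁻¹ * w) ^ 2 = 1 ∧ ∀ i : Fin 4, v⁻¹ * w ≠ v ^ i.val := by
  decide +kernel

/-- A second generator of the normal form group, and its relation to the given element. -/
lemma exists_second_generator (θ : G →* Multiplicative (ZMod 4 × ZMod 2)) {a y : G}
    (ha : θ a ^ 2 ≠ 1) (hy : ∀ i : Fin 4, θ y ≠ θ a ^ i.val) :
    ∃ (b : G) (t : Fin 2), θ b ^ 2 = 1 ∧ (∀ i : Fin 4, θ b ≠ θ a ^ i.val) ∧ y = a ^ t.val * b := by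
  by_cases h : θ y ^ 2 = 1
  · exact ⟨y, 0, h, hy, by simp⟩
  · obtain ⟨h1, h2⟩ := sq_inv_mul_eq_one _ _ ha hy h
    exact ⟨a⁻¹ * y, 1, by simpa using h1, by simpa using h2, by simp⟩

/-- The coordinates exist, and the given generators are in standard position. -/
theorem exists_cocycleCoordinates (p : ℕ) [Fact p.Prime] (P : Subgroup G) [P.Normal]
    (hP : Nat.card P = p) (hindex : P.index = 16) (hcop : p.Coprime 16)
    (θ : G →* Multiplicative (ZMod 4 × ZMod 2)) (hker : θ.ker = commutator G)
    (hle : P ≤ commutator G) (hrel : P.relIndex (commutator G) = 2) {a b : G} (ha : θ a ^ 2 ≠ 1)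
    (hb2 : θ b ^ 2 = 1) (hb : ∀ i : Fin 4, θ b ≠ θ a ^ i.val) :
    ∃ (φ : GaussianInt →+* AlgebraicClosure (ZMod p)) (δ ε : Fin 2) (k : Fin 5)
      (C : CocycleCoordinates G φ δ ε (charPair k).1 (charPair k).2),
      C.pos a = (1, 0, 0) ∧ C.pos b = (0, 1, 0) ∧ ∀ g ∈ P, C.pos g = 0 := by
  have hp : p.Prime := Fact.out
  obtain ⟨δ, ε, z, pos, hz, hmul, hpos0, hpa, hpb, heval⟩ :=
    exists_normalForm P hindex θ hker hrel a b ha hb hb2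
  obtain ⟨χ, τ, hτ, hχP, hτP⟩ := exists_cocycle p hp P hP (by rwa [hindex])
  have hχc : ∀ g ∈ commutator G, χ g = 1 := by
    intro g hg
    have := Abelianization.commutator_subset_ker χ.toHomUnits hg
    simpa [MonoidHom.mem_ker, Units.ext_iff] using this
  have hV4 : ∀ v : Multiplicative (ZMod 4 × ZMod 2), v ^ 4 = 1 := by decide
  let f := algebraMap (ZMod p) (AlgebraicClosure (ZMod p))
  have hχpos : ∀ g, χ g = χ a ^ (pos g).1.val * χ b ^ (pos g).2.1.val := by
    intro g
    have h1 := hχP _ (heval g)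
    have h2 : χ g = χ (NormalForm.eval a b z (pos g)) * χ ((NormalForm.eval a b z (pos g))⁻¹ * g) := by
      rw [← map_mul, mul_inv_cancel_left]
    rw [h2, h1, mul_one, NormalForm.eval, map_mul, map_mul, map_pow, map_pow, map_pow, hχc z hz,
      one_pow, mul_one]
  have hr : f (χ a) ^ 4 = 1 := by
    rw [← map_pow, ← map_pow, hχc (a ^ 4) (by rw [← hker, MonoidHom.mem_ker, map_pow, hV4]), map_one]
  have hs : f (χ b) ^ 2 = 1 := by
    rw [← map_pow, ← map_pow, hχc (b ^ 2) (by rw [← hker, MonoidHom.mem_ker, map_pow, hb2]), map_one]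
  have hrs : ¬(f (χ a) = 1 ∧ f (χ b) = 1) := by
    rintro ⟨h1, h2⟩
    have h1' : χ a = 1 := f.injective (by rw [h1, map_one])
    have h2' : χ b = 1 := f.injective (by rw [h2, map_one])
    -- With trivial action `τ` is a homomorphism to an abelian group, so it kills `P ≤ G'` although
    -- it is injective on `P`.
    let T : G →* Multiplicative (ZMod p) := MonoidHom.mk' (fun g => Multiplicative.ofAdd (τ g))
      (fun g h => by rw [hτ, hχpos, h1', h2', one_pow, one_pow, one_mul, one_mul]; rfl)
    have hbot : P = ⊥ := by
      rw [eq_bot_iff]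
      intro x hx
      have h3 : T x = 1 := Abelianization.commutator_subset_ker T (hle hx)
      exact Subgroup.mem_bot.2 (hτP x hx h3)
    rw [hbot, Subgroup.card_bot] at hP
    exact hp.one_lt.ne hP
  obtain ⟨ι, k, hι, hrι, hsι⟩ := exists_charPair hr hs hrs
  -- Sending `i` to `ι` turns the model characters into `χ`.
  let φ : GaussianInt →+* AlgebraicClosure (ZMod p) := Zsqrtd.lift ⟨ι, by simpa using hι⟩
  have hφ : φ ⟨0, 1⟩ = ι := by simp [φ]
  refine ⟨φ, δ, ε, k, ⟨pos, fun g => f (τ g), hmul, fun g h => ?_, fun g hg h0 => ?_⟩, hpa, hpb,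
    fun g hg => (hpos0 g).2 hg⟩
  · have hχφ : φ (ModelElt.char (charPair k).1 (charPair k).2 (pos g)) = f (χ g) := by
      rw [ModelElt.char, map_pow, hφ, hχpos, map_mul, map_pow, map_pow, hrι, hsι,
        NormalForm.charExp, pow_add, pow_mul, pow_mul]
    rw [hχφ, hτ, map_add, map_mul]
  · exact hτP g ((hpos0 g).1 hg) (f.injective (by rw [h0, map_zero]))

end Assembly

/-! ### The main theorem -/

theorem mainTheorem4 {G : Type*} [Group G] [DecidableEq G] (p : ℕ) (hp : p.Prime) (hodd : Odd p)
    (hcard : Nat.card G = 16 * p)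
    (hP : ∀ P : Sylow p G, (P : Subgroup G).Normal)
    (hab : Nonempty ((G ⧸ commutator G) ≃* Multiplicative (ZMod 4 × ZMod 2)))
    (S : Set G) (hS : Subgroup.closure S = ⊤) :
    ∃ (v : G) (C : (SimpleGraph.mulCayley S).Walk v v), C.IsHamiltonianCycle := by
  have := Fact.mk hp
  have : Finite G := Nat.finite_of_card_ne_zero (by rw [hcard]; have := hp.pos; omega)
  obtain ⟨e⟩ := hab
  have hcop2 : p.Coprime 2 := Nat.coprime_two_right.2 hodd
  have hcop : p.Coprime 16 := hcop2.pow_right 4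
  have hndvd : ¬p ∣ 16 := fun h => hp.one_lt.ne' (Nat.eq_one_of_dvd_coprimes hcop dvd_rfl h)
  obtain ⟨Q⟩ : Nonempty (Sylow p G) := inferInstance
  have hnormal := hP Q
  set P : Subgroup G := Q.toSubgroup
  have hPcard : Nat.card P = p := by
    have h := Q.card_eq_multiplicity
    rw [hcard, Nat.factorization_mul (by norm_num) hp.ne_zero, Finsupp.add_apply,
      Nat.factorization_eq_zero_of_not_dvd hndvd, hp.factorization_self, zero_add, pow_one] at h
    exact h
  have hindex : P.index = 16 := by
    have h := P.card_mul_index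
    rw [hPcard, hcard, mul_comm 16] at h
    exact Nat.eq_of_mul_eq_mul_left hp.pos h
  let θ : G →* Multiplicative (ZMod 4 × ZMod 2) :=
    e.toMonoidHom.comp (QuotientGroup.mk' (commutator G))
  have hsurj : Function.Surjective θ :=
    e.surjective.comp (QuotientGroup.mk'_surjective _)
  have hker : θ.ker = commutator G := by
    ext g
    simp [θ]
  have hV4 : ∀ v : Multiplicative (ZMod 4 × ZMod 2), v ^ 4 = 1 := by decide
  -- The image of `P` in `G/G'` has exponent dividing both `p` and 4.
  have hle : P ≤ commutator G := by
    intro x hx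
    rw [← hker, MonoidHom.mem_ker, ← orderOf_eq_one_iff]
    have hxp : x ^ p = 1 := by
      have h := pow_card_eq_one' (x := (⟨x, hx⟩ : P))
      rw [hPcard] at h
      simpa using congrArg Subtype.val h
    exact Nat.eq_one_of_dvd_coprimes (hcop2.pow_right 2)
      (orderOf_dvd_of_pow_eq_one (by rw [← map_pow, hxp, map_one]))
      (orderOf_dvd_of_pow_eq_one (hV4 _))
  have hindex' : (commutator G).index = 8 := by
    rw [Subgroup.index, Nat.card_congr e.toEquiv]
    simp
  have hrel : P.relIndex (commutator G) = 2 := by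
    have h := Subgroup.relIndex_mul_index hle
    rw [hindex', hindex] at h
    omega
  obtain ⟨a, ha, y, hy, ha2, hya⟩ := exists_generators hS θ hsurj
  obtain ⟨b, t, hb2, hb, rfl⟩ := exists_second_generator θ ha2 hya
  obtain ⟨φ, δ, ε, k, C, hCa, hCb, hCP⟩ :=
    exists_cocycleCoordinates p P hPcard hindex hcop θ hker hle hrel ha2 hb2 hb
  have : CharP (AlgebraicClosure (ZMod p)) p :=
    charP_of_injective_algebraMap (algebraMap (ZMod p) _).injective p
  have : Nontrivial P := Finite.one_lt_card_iff_nontrivial.1 (by rw [hPcard]; exact hp.one_lt)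
  obtain ⟨g₀, hg₀⟩ := exists_ne (1 : P)
  refine C.exists_isHamiltonianCycle hS hp hodd hcard (t := t) (hCP g₀ g₀.2)
    (fun h => hg₀ (Subtype.ext h)) ha hy hCa ?_
  have hpow : ∀ t : Fin 2, C.pos (a ^ t.val) = (Fin.castLE (by omega) t, 0, 0) := by
    intro t
    fin_cases t
    · exact (congrArg C.pos (pow_zero a)).trans C.pos_one
    · exact (congrArg C.pos (pow_one a)).trans hCa
  rw [C.pos_mul, hpow, hCb]
  exact NormalForm.mul_second_generator δ ε t
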